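/- Let $k$ be a field, let $n\ge 1$, and let $G$ be a graph with vertex set $[n]=\{1,\ldots,n\}$. Put $S=k[x_1,\ldots,x_n]$ with its standard grading. Let $\Delta_1^t(G)$ be the simplicial complex on $[n]$ generated by the complements $[n]\setminus T$ of the independent sets $T$ of $G$ of size $1$, and let $\Delta_1^t(G)^\vee=\{F\subseteq[n] : [n]\setminus F\notin\Delta_1^t(G)\}$ be its Alexander dual. For a simplicial complex $\Sigma$ on $[n]$ let $k[\Sigma]=S/I_\Sigma$ be its Stanley–Reisner ring, where $I_\Sigma$ is generated by the squarefree monomials $\prod_{i\in F}x_i$ with $F\subseteq[n]$, $F\notin\Sigma$. Then: 1. $I_{\Delta_1^t(G)}=(x_1x_2\cdots x_n)$ and $I_{\Delta_1^t(G)^\vee}=(x_1,\ldots,x_n)$, that is, $k[\Delta_1^t(G)]=S/(x_1x_2\cdots x_n)$ and $k[\Delta_1^t(G)^\vee]=S/(x_1,\ldots,x_n)$. 2. Both rings are Cohen–Macaulay. 3. Both rings have a linear resolution over $S$: for some $s$ (depending on the ring), the minimal graded free resolution over $S$ has, for every $i\ge1$, all generators of its $i$-th module in degree $s+i-1$. 4.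 The graded Betti numbers over $S$, that is, the numbers $\beta_{i,j}$ of generators of degree $j$ of the $i$-th module in a minimal graded free resolution, are $\beta_{0,0}=\beta_{1,n}=1$ and $\beta_{i,j}=0$ otherwise for $k[\Delta_1^t(G)]$, and $\beta_{i,i}=\binom ni$ for all $i\ge0$ and $\beta_{i,j}=0$ for $i\ne j$ for $k[\Delta_1^t(G)^\vee]$. 5. The Koszul complex on $x_1,\ldots,x_n$ over $S$ is a minimal graded free resolution of $k[\Delta_1^t(G)^\vee]$. -/

import Mathlib

/-- A simplicial complex on the finite vertex set `V`: a family of subsets of `V` closed under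
passing to subsets. The void complex (no face at all) and the complex whose only face is the
empty set are both allowed, and not every element of `V` has to be a face. -/
@[ext] structure FinSimplicialComplex (V : Type*) where
  faces : Set (Finset V)
  down_closed : ∀ {F F' : Finset V}, F ∈ faces → F' ⊆ F → F' ∈ faces

/-- The Alexander dual `{F ⊆ V | V \ F is not a face of Δ}`. -/
def FinSimplicialComplex.alexanderDual {V : Type*} [Fintype V] [DecidableEq V]
    (Δ : FinSimplicialComplex V) : FinSimplicialComplex V where
  faces := {F | Fᶜ ∉ Δ.faces}
  down_closed := fun hF hsub hF' => hF (Δ.down_closed hF' (Finset.compl_subset_compl.mpr hsub))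

/-- The total cut complex `Δ_r^t(G)`: the simplicial complex generated by (that is, with facets)
the complements of the independent sets of size `r` of the graph `G`. -/
def totalCutComplex {V : Type*} [Fintype V] [DecidableEq V] (G : SimpleGraph V) (r : ℕ) :
    FinSimplicialComplex V where
  faces := {F | ∃ T : Finset V, G.IsNIndepSet r T ∧ F ⊆ Tᶜ}
  down_closed := fun ⟨T, hT, hF⟩ hsub => ⟨T, hT, hsub.trans hF⟩

/-- The Stanley-Reisner ideal, generated by the squarefree monomials of all non-faces. -/
noncomputable def stanleyReisnerIdeal {V : Type*} (K : Type*) [Field K]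
    (Δ : FinSimplicialComplex V) : Ideal (MvPolynomial V K) :=
  Ideal.span {p | ∃ F : Finset V, F ∉ Δ.faces ∧ p = ∏ i ∈ F, MvPolynomial.X i}

/-- The Stanley-Reisner ring `K[Δ]`. -/
abbrev StanleyReisnerRing {V : Type*} (K : Type*) [Field K] (Δ : FinSimplicialComplex V) : Type _ :=
  MvPolynomial V K ⧸ stanleyReisnerIdeal K Δ

/-- The depth of a local ring: the supremum of the lengths of the regular sequences contained in
the maximal ideal. -/
noncomputable def localRingDepth (R : Type*) [CommRing R] [IsLocalRing R] : ℕ∞ :=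
  ⨆ (rs : List R) (_ : RingTheory.Sequence.IsRegular R rs ∧
    ∀ r ∈ rs, r ∈ IsLocalRing.maximalIdeal R), (rs.length : ℕ∞)

/-- A Noetherian ring is Cohen-Macaulay if depth and Krull dimension agree for the localization
at every maximal ideal. -/
def IsCohenMacaulayRing (R : Type*) [CommRing R] : Prop :=
  IsNoetherianRing R ∧ ∀ (m : Ideal R) [m.IsMaximal],
    (localRingDepth (Localization.AtPrime m) : WithBot ℕ∞) =
      ringKrullDim (Localization.AtPrime m)

/-- The data of a sequence `F_0 ← F_1 ← F_2 ← ⋯` of finite free modules with chosen bases over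
the polynomial ring `S = K[V]`. The module `F_i = ⊕_a S[-deg i a]` has a basis indexed by
`index i`, the basis element `a` has degree `deg i a`, and `diff i : F_{i+1} → F_i` is given by
its matrix. -/
structure FreeSequence (V : Type*) (K : Type*) [Field K] where
  index : ℕ → Type
  [fintypeIndex : ∀ i, Fintype (index i)]
  deg : ∀ i, index i → ℕ
  diff : ∀ i, Matrix (index i) (index (i + 1)) (MvPolynomial V K)

attribute [instance] FreeSequence.fintypeIndex

namespace FreeSequence

variable {V : Type*} {K : Type*} [Field K]

/-- The differential `F_{i+1} → F_i` as a linear map. -/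
noncomputable def d (F : FreeSequence V K) (i : ℕ) :
    (F.index (i + 1) → MvPolynomial V K) →ₗ[MvPolynomial V K] (F.index i → MvPolynomial V K) :=
  (F.diff i).mulVecLin

/-- `F` is a minimal graded free resolution of `S / I`. The augmentation `F_0 → S / I` sends the
basis element `b` to the class of `g b`. -/
structure IsMinimalResolution (F : FreeSequence V K) (I : Ideal (MvPolynomial V K)) : Prop where
  /-- the differentials are homogeneous of degree zero -/
  graded : ∀ i (b : F.index i) (a : F.index (i + 1)), F.diff i b a = 0 ∨
    ∃ e, e + F.deg i b = F.deg (i + 1) a ∧ (F.diff i b a).IsHomogeneous e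
  /-- the image of each differential lies in `(x_1, …, x_n) F_i` -/
  minimal : ∀ i (b : F.index i) (a : F.index (i + 1)),
    MvPolynomial.constantCoeff (F.diff i b a) = 0
  exact : ∀ i, Function.Exact (F.d (i + 1)) (F.d i)
  augmented : ∃ g : F.index 0 → MvPolynomial V K,
    (∀ b, (g b).IsHomogeneous (F.deg 0 b)) ∧
    Function.Exact (F.d 0)
      (Fintype.linearCombination (MvPolynomial V K) (fun b => Ideal.Quotient.mk I (g b))) ∧
    Function.Surjective
      (Fintype.linearCombination (MvPolynomial V K) (fun b => Ideal.Quotient.mk I (g b)))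

/-- The number of basis elements of degree `j` in homological degree `i`. -/
noncomputable def gradedRank (F : FreeSequence V K) (i j : ℕ) : ℕ :=
  Nat.card {a : F.index i // F.deg i a = j}

end FreeSequence

/-- `S / I` has a minimal graded free resolution, and its graded Betti numbers (the graded ranks
in any minimal graded free resolution) are `β i j`. -/
def HasGradedBettiNumbers {V K : Type*} [Field K] (I : Ideal (MvPolynomial V K))
    (β : ℕ → ℕ → ℕ) : Prop :=
  (∃ F : FreeSequence V K, F.IsMinimalResolution I) ∧
    ∀ F : FreeSequence V K, F.IsMinimalResolution I → ∀ i j, F.gradedRank i j = β i j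

/-- `S / I` has a linear resolution: for some `s`, its minimal graded free resolution has, in
every homological degree `i + 1 ≥ 1`, all its generators in degree `s + i`. -/
def HasLinearResolution {V K : Type*} [Field K] (I : Ideal (MvPolynomial V K)) : Prop :=
  ∃ s : ℕ, ∃ F : FreeSequence V K, F.IsMinimalResolution I ∧
    ∀ i (a : F.index (i + 1)), F.deg (i + 1) a = s + i

/-- The Koszul complex on the variables `x_1, …, x_n`. In homological degree `i` it has the basis
`e_A`, where `A` runs through the `i`-element subsets of the variables, and
`d e_A = ∑_{t ∈ A} (-1)^{#{u ∈ A | u < t}} x_t e_{A \ {t}}`. -/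
noncomputable def koszulComplex (n : ℕ) (K : Type*) [Field K] : FreeSequence (Fin n) K where
  index := fun i => {A : Finset (Fin n) // A.card = i}
  deg := fun i _ => i
  diff := fun _ B A => ∑ t ∈ A.1, if B.1 = A.1.erase t then
    (-1) ^ (A.1.filter (fun u => u < t)).card * MvPolynomial.X t else 0

/-! Singletons are independent in every graph, so the complex is the boundary of the simplex and its
dual has only the empty face; this gives both ideals, independently of `G`. Cohen–Macaulayness: in a
Noetherian ring of dimension at most `d`, it suffices that every maximal ideal contains a weakly
regular sequence of length `d` (`isCohenMacaulayRing`). This property holds for polynomial rings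
over a field by induction and passes along flat integral maps. A coordinate change makes `x_1 ⋯ x_n`
monic in one variable, so its quotient is finite free over a polynomial ring in `n - 1` variables.
The other quotient has dimension zero. Resolutions: `0 ← S ← S[-n] ← 0` and the Koszul complex,
whose exactness comes from an explicit homotopy on monomials (`d_homotopy`). Both are visibly
linear. Betti numbers must agree for all minimal resolutions: graded comparison maps in both
directions compose to maps homotopic to the identity, and by minimality the homotopy terms vanish
modulo the variables, so the graded ranks coincide (`gradedRank_eq`). -/

/-! ### Regular sequences in maximal ideals and Cohen–Macaulayness -/

open RingTheory.Sequence in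
/-- Every maximal ideal contains a weakly regular sequence of length `d`. -/
def MaximalIdealsContainRegularSequence (R : Type*) [CommRing R] (d : ℕ) : Prop :=
  ∀ m : Ideal R, m.IsMaximal → ∃ rs : List R, rs.length = d ∧ (∀ r ∈ rs, r ∈ m) ∧
    IsWeaklyRegular R rs

namespace MaximalIdealsContainRegularSequence

open RingTheory.Sequence

variable {R S : Type*} [CommRing R] [CommRing S] {d : ℕ}

theorem zero : MaximalIdealsContainRegularSequence R 0 :=
  fun _ _ => ⟨[], rfl, by simp, IsWeaklyRegular.nil R R⟩

/-- Integrality makes the contraction of a maximal ideal maximal, and flatness carries its weakly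
regular sequence back up. -/
theorem of_flat_of_isIntegral (h : MaximalIdealsContainRegularSequence R d) (f : R →+* S)
    (hflat : f.Flat) (hint : f.IsIntegral) : MaximalIdealsContainRegularSequence S d := by
  intro m hm
  obtain ⟨rs, hlen, hmem, hreg⟩ :=
    h (m.comap f) (Ideal.isMaximal_comap_of_isIntegral_of_isMaximal' f hint m)
  algebraize [f]
  have : Module.Flat R S := hflat
  refine ⟨rs.map f, by simpa using hlen, ?_, hreg.of_flat⟩
  intro r hr
  obtain ⟨a, ha, rfl⟩ := List.mem_map.mp hr
  exact hmem a ha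

theorem of_ringEquiv (h : MaximalIdealsContainRegularSequence R d) (e : R ≃+* S) :
    MaximalIdealsContainRegularSequence S d :=
  h.of_flat_of_isIntegral e.toRingHom (RingHom.Flat.of_bijective e.bijective)
    (RingHom.isIntegral_of_surjective _ e.surjective)

open Polynomial in
-- Over a Jacobson ring, `R[X] ⧸ m` is integral over `R`, so `m` contains a monic `g`. It is
-- regular, and `R[X] ⧸ (g)` is free over `R`, so a sequence from the contraction of `m` stays
-- weakly regular after `g`.
theorem polynomial [IsJacobsonRing R] (h : MaximalIdealsContainRegularSequence R d) :
    MaximalIdealsContainRegularSequence R[X] (d + 1) := by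
  intro m hm
  have hint : ((Ideal.Quotient.mk m).comp C).IsIntegral :=
    Polynomial.quotient_mk_comp_C_isIntegral_of_isJacobsonRing m
  obtain ⟨g, hg, hg0⟩ := hint (Ideal.Quotient.mk m X)
  have hgm : g ∈ m := by
    rw [← Ideal.Quotient.eq_zero_iff_mem, ← hg0, ← Polynomial.hom_eval₂, Polynomial.eval₂_C_X]
  obtain ⟨rs, hlen, hmem, hreg⟩ := h _ (Polynomial.isMaximal_comap_C_of_isJacobsonRing m)
  refine ⟨g :: rs.map C, by simpa using hlen, ?_, IsWeaklyRegular.cons' ?_ ?_⟩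
  · intro r hr
    obtain rfl | hr := List.mem_cons.mp hr
    · exact hgm
    · obtain ⟨a, ha, rfl⟩ := List.mem_map.mp hr
      exact hmem a ha
  · intro a b hab
    exact hg.isRegular.left hab
  · have : Module.Free R (R[X] ⧸ Ideal.span {g}) := hg.free_quotient
    have hq : IsWeaklyRegular (R[X] ⧸ Ideal.span {g})
        (rs.map (algebraMap R (R[X] ⧸ Ideal.span {g}))) := hreg.of_flat
    rw [List.map_map]
    -- Moves weak regularity from the ring quotient to the module quotient required by
    -- `IsWeaklyRegular.cons'`.
    have e : (R[X] ⧸ Ideal.span {g}) ≃ₗ[R[X]] QuotSMulTop g R[X] :=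
      Submodule.quotEquivOfEq _ _ (by rw [← Submodule.ideal_span_singleton_smul]; simp)
    refine (AddEquiv.isWeaklyRegular_congr (e := e.toAddEquiv) ?_).mp hq
    rw [List.forall₂_map_left_iff, List.forall₂_map_right_iff, List.forall₂_same]
    intro r _ x
    have h1 : algebraMap R (R[X] ⧸ Ideal.span {g}) r • x = (C r : R[X]) • x := rfl
    rw [h1]
    exact e.map_smul _ _

theorem mvPolynomial (K : Type*) [Field K] (d : ℕ) :
    MaximalIdealsContainRegularSequence (MvPolynomial (Fin d) K) d := by
  induction d with
  | zero => exact zero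
  | succ d ih => exact ih.polynomial.of_ringEquiv (MvPolynomial.finSuccEquiv K d).symm.toRingEquiv

/-- A regular sequence lowers the dimension of a local ring by its length, so depth is at most
dimension. Conversely the dimension at `m` is at most `d`, and the given sequence localizes to a
regular one of length `d`. -/
theorem isCohenMacaulayRing [IsNoetherianRing R] (h : MaximalIdealsContainRegularSequence R d)
    (hdim : ringKrullDim R ≤ d) : IsCohenMacaulayRing R := by
  refine ⟨inferInstance, fun m hm => le_antisymm ?_ ?_⟩
  · have hne : ringKrullDim (Localization.AtPrime m) ≠ ⊥ := ringKrullDim_ne_bot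
    obtain ⟨k, hk⟩ := WithBot.ne_bot_iff_exists.mp hne
    rw [← hk, WithBot.coe_le_coe]
    refine iSup₂_le fun rs hrs => ?_
    rw [← WithBot.coe_le_coe, hk]
    have := ringKrullDim_add_length_eq_ringKrullDim_of_isRegular rs hrs.1
    rw [← this]
    have h0 : ringKrullDim (Localization.AtPrime m ⧸ Ideal.ofList rs) ≠ ⊥ := by
      intro hb
      rw [hb, WithBot.bot_add] at this
      exact hne this.symm
    obtain ⟨l, hl⟩ := WithBot.ne_bot_iff_exists.mp h0
    rw [← hl]
    norm_cast
    exact le_add_self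
  · obtain ⟨rs, hlen, hmem, hreg⟩ := h m hm
    have hle : ringKrullDim (Localization.AtPrime m) ≤ d :=
      (IsLocalization.AtPrime.ringKrullDim_eq_height m _).le.trans
        ((Ideal.height_le_ringKrullDim_of_ne_top Ideal.IsPrime.ne_top').trans hdim)
    refine hle.trans ?_
    have hreg' := hreg.isRegular_of_isLocalization_of_mem (Localization.AtPrime m) m hmem
    have : (d : ℕ∞) ≤ localRingDepth (Localization.AtPrime m) := by
      refine le_iSup₂_of_le (rs.map (algebraMap R _)) ⟨hreg', ?_⟩ (by simp [hlen])
      intro r hr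
      obtain ⟨a, ha, rfl⟩ := List.mem_map.mp hr
      exact (IsLocalization.AtPrime.to_map_mem_maximal_iff _ m a).mpr (hmem a ha)
    exact_mod_cast WithBot.coe_le_coe.mpr this

end MaximalIdealsContainRegularSequence

/-! ### The coordinate change making the product of the variables monic -/

section Shear

open Polynomial

variable (K : Type*) [Field K] (d : ℕ)

/-- The coordinate change `x_0 ↦ T`, `x_{i+1} ↦ y_i + T`. -/
noncomputable def mvPolynomialShear :
    MvPolynomial (Fin (d + 1)) K ≃ₐ[K] (MvPolynomial (Fin d) K)[X] :=
  (AlgEquiv.ofAlgHom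
    (MvPolynomial.aeval (Fin.cons (MvPolynomial.X 0)
      fun i => MvPolynomial.X i.succ + MvPolynomial.X 0))
    (MvPolynomial.aeval (Fin.cons (MvPolynomial.X 0)
      fun i => MvPolynomial.X i.succ - MvPolynomial.X 0))
    (MvPolynomial.algHom_ext fun i => by cases i using Fin.cases <;> simp)
    (MvPolynomial.algHom_ext fun i => by cases i using Fin.cases <;> simp)).trans
  (MvPolynomial.finSuccEquiv K d)

theorem mvPolynomialShear_prod_X_monic :
    (mvPolynomialShear K d (∏ i, MvPolynomial.X i)).Monic := by
  rw [map_prod]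
  refine monic_prod_of_monic _ _ fun i _ => ?_
  cases i using Fin.cases with
  | zero =>
    have : mvPolynomialShear K d (MvPolynomial.X 0) = X := by
      simp [mvPolynomialShear, MvPolynomial.finSuccEquiv_X_zero]
    rw [this]
    exact monic_X
  | succ i =>
    have : mvPolynomialShear K d (MvPolynomial.X i.succ) = X + C (MvPolynomial.X i) := by
      simp [mvPolynomialShear, MvPolynomial.finSuccEquiv_X_zero, MvPolynomial.finSuccEquiv_X_succ,
        add_comm]
    rw [this]
    exact monic_X_add_C _

theorem isCohenMacaulayRing_quotient_prod_X : IsCohenMacaulayRing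
    (MvPolynomial (Fin (d + 1)) K ⧸
      Ideal.span {∏ i : Fin (d + 1), (MvPolynomial.X i : MvPolynomial (Fin (d + 1)) K)}) := by
  set f : MvPolynomial (Fin (d + 1)) K := ∏ i, MvPolynomial.X i with hf
  have hg := mvPolynomialShear_prod_X_monic K d
  rw [← hf] at hg
  set g := mvPolynomialShear K d f
  have e : ((MvPolynomial (Fin d) K)[X] ⧸ Ideal.span {g}) ≃+*
      (MvPolynomial (Fin (d + 1)) K ⧸ Ideal.span {f}) :=
    (Ideal.quotientEquiv (Ideal.span {f}) (Ideal.span {g}) (mvPolynomialShear K d).toRingEquiv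
      (by rw [Ideal.map_span, Set.image_singleton]; rfl)).symm
  have := hg.free_quotient
  have := hg.finite_quotient
  refine (((MaximalIdealsContainRegularSequence.mvPolynomial K d).of_flat_of_isIntegral
    (algebraMap _ ((MvPolynomial (Fin d) K)[X] ⧸ Ideal.span {g}))
    (RingHom.flat_algebraMap_iff.mpr inferInstance)
    (algebraMap_isIntegral_iff.mpr inferInstance)).of_ringEquiv e).isCohenMacaulayRing ?_
  -- Dividing by a nonzerodivisor drops the dimension `d + 1` by at least one.
  have hf0 : f ∈ nonZeroDivisors (MvPolynomial (Fin (d + 1)) K) :=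
    mem_nonZeroDivisors_of_ne_zero (Finset.prod_ne_zero_iff.mpr fun i _ => MvPolynomial.X_ne_zero i)
  have h := ringKrullDim_quotient_succ_le_of_nonZeroDivisor hf0
  rw [MvPolynomial.ringKrullDim_of_isNoetherianRing, ringKrullDim_eq_zero_of_field] at h
  simp only [Nat.card_eq_fintype_card, Fintype.card_fin, zero_add, Nat.cast_add, Nat.cast_one] at h
  exact ENat.WithBot.add_le_add_one_right_iff.mp h

end Shear

theorem isCohenMacaulayRing_quotient_range_X (K : Type*) [Field K] (n : ℕ) : IsCohenMacaulayRing
    (MvPolynomial (Fin n) K ⧸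
      Ideal.span (Set.range (MvPolynomial.X : Fin n → MvPolynomial (Fin n) K))) := by
  refine MaximalIdealsContainRegularSequence.zero.isCohenMacaulayRing ?_
  have h : Function.Surjective
      ((Ideal.Quotient.mk (Ideal.span (Set.range
        (MvPolynomial.X : Fin n → MvPolynomial (Fin n) K)))).comp MvPolynomial.C) := by
    rw [← RingHom.range_eq_top, eq_top_iff]
    rintro x -
    obtain ⟨p, rfl⟩ := Ideal.Quotient.mk_surjective x
    induction p using MvPolynomial.induction_on with
    | C a => exact RingHom.mem_range.mpr ⟨a, rfl⟩
    | add p q hp hq => rw [map_add]; exact add_mem hp hq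
    | mul_X p i hp =>
      rw [map_mul, Ideal.Quotient.eq_zero_iff_mem.mpr (Ideal.subset_span (Set.mem_range_self i)),
        mul_zero]
      exact zero_mem _
  exact (ringKrullDim_le_of_surjective _ h).trans (by simp [ringKrullDim_eq_zero_of_field])

/-! ### The Koszul differential and its contracting homotopy -/

namespace KoszulChain

open MvPolynomial Finset

variable {n : ℕ} {K : Type*} [Field K]

/-- The sign `(-1)^{#{u ∈ B | u < t}}`. -/
def sign (K : Type*) [Field K] (t : Fin n) (B : Finset (Fin n)) : K :=
  (-1) ^ (B.filter (fun u => u < t)).card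

/-- The Koszul differential on families of polynomials indexed by all subsets. -/
noncomputable def d (z : Finset (Fin n) → MvPolynomial (Fin n) K) (B : Finset (Fin n)) :
    MvPolynomial (Fin n) K :=
  ∑ t ∈ Bᶜ, sign K t B • (X t * z (insert t B))

theorem sign_insert_self (t : Fin n) (B : Finset (Fin n)) :
    sign K t (insert t B) = sign K t B := by
  rw [sign, filter_insert, if_neg (lt_irrefl t), sign]

theorem sign_insert_of_lt {s t : Fin n} {B : Finset (Fin n)} (hs : s ∉ B) (h : s < t) :
    sign K t (insert s B) = -sign K t B := by
  rw [sign, filter_insert, if_pos h, card_insert_of_notMem (by simp [hs]), pow_succ, sign]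
  ring

theorem sign_insert_of_gt {s t : Fin n} {B : Finset (Fin n)} (h : t < s) :
    sign K t (insert s B) = sign K t B := by
  rw [sign, filter_insert, if_neg h.not_gt, sign]

theorem sign_of_forall_le {t : Fin n} {B : Finset (Fin n)} (h : ∀ u ∈ B, t ≤ u) :
    sign K t B = 1 := by
  rw [sign, filter_eq_empty_iff.mpr (fun u hu => (h u hu).not_gt), card_empty, pow_zero]

/-- Adding `s` then `t` cancels against adding `t` then `s`: the larger element sees one more
smaller element in exactly one of the two orders. -/
theorem d_d (z : Finset (Fin n) → MvPolynomial (Fin n) K) (B : Finset (Fin n)) :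
    d (d z) B = 0 := by
  have hanti : ∀ s t : Fin n, s ∉ B → t ∉ B → s < t →
      sign K s B * sign K t (insert s B) + sign K t B * sign K s (insert t B) = 0 := by
    intro s t hs ht h
    rw [sign_insert_of_lt hs h, sign_insert_of_gt h]
    ring
  simp only [d, mul_sum, smul_sum, mul_smul_comm, smul_smul]
  rw [sum_sigma']
  refine sum_involution (fun x _ => ⟨x.2, x.1⟩) ?_ ?_ ?_ ?_
  · rintro ⟨s, t⟩ hx
    simp only [mem_sigma, mem_compl, mem_insert, not_or] at hx
    obtain ⟨hs, hts, ht⟩ := hx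
    simp only [Finset.insert_comm t s B, mul_left_comm (X s : MvPolynomial (Fin n) K)]
    rw [← add_smul]
    rcases lt_or_gt_of_ne hts with h | h
    · rw [add_comm, hanti t s ht hs h, zero_smul]
    · rw [hanti s t hs ht h, zero_smul]
  · rintro ⟨s, t⟩ hx - h
    simp only [mem_sigma, mem_compl, mem_insert, not_or] at hx
    simp only [Sigma.mk.injEq, heq_eq_eq] at h
    exact hx.2.1 h.1
  · rintro ⟨s, t⟩ hx
    simp only [mem_sigma, mem_compl, mem_insert, not_or] at hx ⊢
    exact ⟨hx.2.2, fun h => hx.2.1 h.symm, hx.1⟩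
  · intros; rfl

open Classical in
/-- The contracting homotopy: `x^c e_B` is sent to `x^{c - t} e_{B ∪ {t}}`, where `t` is the least
element of `B ∪ supp c`, and to `0` if `t ∈ B`. -/
noncomputable def homotopy (z : Finset (Fin n) → MvPolynomial (Fin n) K) (A : Finset (Fin n)) :
    MvPolynomial (Fin n) K :=
  if h : A.Nonempty then
    let p := (z (A.erase (A.min' h))).divMonomial (Finsupp.single (A.min' h) 1)
    ∑ c ∈ p.support with ∀ u ∈ c.support, A.min' h ≤ u, monomial c (coeff c p)
  else 0

theorem coeff_homotopy_of_mem (z : Finset (Fin n) → MvPolynomial (Fin n) K) {A : Finset (Fin n)}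
    {t : Fin n} {c : Fin n →₀ ℕ} (ht : t ∈ A) (hA : ∀ u ∈ A, t ≤ u)
    (hc : ∀ u ∈ c.support, t ≤ u) :
    coeff c (homotopy z A) = coeff (Finsupp.single t 1 + c) (z (A.erase t)) := by
  have h : A.Nonempty := ⟨t, ht⟩
  have hmin : A.min' h = t := le_antisymm (A.min'_le t ht) (A.le_min' h t hA)
  rw [homotopy, dif_pos h]
  simp only [hmin, coeff_sum, coeff_monomial, sum_ite_eq', mem_filter, coeff_divMonomial]
  split_ifs with h'
  · rfl
  · by_contra hne
    refine h' ⟨?_, hc⟩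
    rw [mem_support_iff, coeff_divMonomial]
    exact fun h0 => hne h0.symm

theorem coeff_homotopy_of_notMem (z : Finset (Fin n) → MvPolynomial (Fin n) K)
    {A : Finset (Fin n)} {t : Fin n} {c : Fin n →₀ ℕ} (ht : t ∉ A) (hA : ∀ u ∈ A, t ≤ u)
    (hc : t ∈ c.support) : coeff c (homotopy z A) = 0 := by
  rw [homotopy]
  split_ifs with h
  · simp only [coeff_sum, coeff_monomial, sum_ite_eq', mem_filter]
    rw [if_neg]
    rintro ⟨-, h'⟩
    have h1 := h' t hc
    have h2 := hA _ (A.min'_mem h)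
    exact ht (le_antisymm h2 h1 ▸ A.min'_mem h)
  · exact coeff_zero c

theorem coeff_d (z : Finset (Fin n) → MvPolynomial (Fin n) K) (B : Finset (Fin n))
    (c : Fin n →₀ ℕ) : coeff c (d z B) = ∑ t ∈ Bᶜ, if t ∈ c.support then
      sign K t B * coeff (c - Finsupp.single t 1) (z (insert t B)) else 0 := by
  simp only [d, coeff_sum, coeff_smul, coeff_X_mul', smul_eq_mul, mul_ite, mul_zero]

/-- Compare coefficients of `x^c e_B`, with `t` the least element of `B ∪ supp c`. If `t ∉ B`, only
the summand `t` survives and it returns the coefficient of `z`. If `t ∈ B`, the cycle condition at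
`B \ {t}` is needed. If there is no `t`, the coefficient vanishes by `h0`. -/
theorem d_homotopy {z : Finset (Fin n) → MvPolynomial (Fin n) K} (hz : ∀ B, d z B = 0)
    (h0 : constantCoeff (z ∅) = 0) (B : Finset (Fin n)) : d (homotopy z) B = z B := by
  ext c
  rw [coeff_d]
  rcases (B ∪ c.support).eq_empty_or_nonempty with hU | hU
  · obtain ⟨rfl, hc⟩ := union_eq_empty.mp hU
    rw [Finsupp.support_eq_empty] at hc
    subst hc
    simpa [constantCoeff_eq] using h0.symm
  obtain ⟨t, htU, hmin⟩ : ∃ t ∈ B ∪ c.support, ∀ u ∈ B ∪ c.support, t ≤ u :=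
    ⟨_, min'_mem _ hU, fun u hu => min'_le _ u hu⟩
  have hB : ∀ u ∈ B, t ≤ u := fun u hu => hmin u (mem_union_left _ hu)
  have hc : ∀ u ∈ c.support, t ≤ u := fun u hu => hmin u (mem_union_right _ hu)
  have hsub : ∀ s u, u ∈ (c - Finsupp.single s 1).support → t ≤ u := fun s u hu =>
    hc u (Finsupp.support_mono tsub_le_self hu)
  by_cases htB : t ∈ B
  -- In this coefficient the summand `t` is the wanted coefficient of `z B`; the others match those
  -- of `d (homotopy z) B` up to sign, since removing `t < s` from `B` flips the sign of `s`.
  · have hd := congrArg (coeff (c + Finsupp.single t 1)) (hz (B.erase t))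
    have hcompl : (B.erase t)ᶜ = insert t Bᶜ := by
      ext u; simp only [mem_compl, mem_erase, mem_insert]; tauto
    rw [coeff_d, hcompl, sum_insert (by simpa using htB), if_pos (by simp), add_tsub_cancel_right,
      insert_erase htB, sign_of_forall_le (fun u hu => hB u (mem_of_mem_erase hu)), one_mul,
      coeff_zero] at hd
    rw [eq_neg_of_add_eq_zero_left hd, ← sum_neg_distrib]
    refine sum_congr rfl fun s hs => ?_
    have hsB : s ∉ B := mem_compl.mp hs
    have hst : s ≠ t := fun h => hsB (h ▸ htB)
    have hmem : s ∈ (c + Finsupp.single t 1).support ↔ s ∈ c.support := by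
      simp [hst.symm]
    by_cases hsc : s ∈ c.support
    · have hts : t < s := lt_of_le_of_ne (hc s hsc) hst.symm
      rw [if_pos hsc, if_pos (hmem.mpr hsc), coeff_homotopy_of_mem z (mem_insert_of_mem htB)
        (fun u hu => ?_) (hsub s), erase_insert_of_ne hst]
      · have hsgn : sign K s B = -sign K s (B.erase t) := by
          rw [← sign_insert_of_lt (notMem_erase t B) hts, insert_erase htB]
        have hexp : Finsupp.single t 1 + (c - Finsupp.single s 1) =
            c + Finsupp.single t 1 - Finsupp.single s 1 := by
          rw [add_comm c, add_tsub_assoc_of_le]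
          simpa [Nat.one_le_iff_ne_zero] using hsc
        rw [hsgn, hexp, neg_mul]
      · rcases mem_insert.mp hu with rfl | hu
        · exact hts.le
        · exact hB u hu
    · rw [if_neg hsc, if_neg (fun h => hsc (hmem.mp h)), neg_zero]
  · have htc : t ∈ c.support := (mem_union.mp htU).resolve_left htB
    rw [sum_eq_single_of_mem t (mem_compl.mpr htB), if_pos htc, sign_of_forall_le hB, one_mul,
      coeff_homotopy_of_mem z (mem_insert_self t B) (fun u hu => ?_) (hsub t),
      erase_insert htB, add_tsub_cancel_of_le]
    · simpa [Nat.one_le_iff_ne_zero] using htc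
    · rcases mem_insert.mp hu with rfl | hu
      · exact le_rfl
      · exact hB u hu
    · intro s hs hst
      split_ifs with hsc
      · rw [coeff_homotopy_of_notMem z (t := t), mul_zero]
        · simp [hst.symm, htB]
        · intro u hu
          rcases mem_insert.mp hu with rfl | hu
          · exact hc _ hsc
          · exact hB u hu
        · simpa [Finsupp.single_apply, hst] using htc
      · rfl

/-- Extension by zero of a family indexed by the `i`-element subsets. -/
noncomputable def extend {i : ℕ} (z : {A : Finset (Fin n) // A.card = i} → MvPolynomial (Fin n) K)
    (A : Finset (Fin n)) : MvPolynomial (Fin n) K :=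
  if h : A.card = i then z ⟨A, h⟩ else 0

theorem extend_apply {i : ℕ} (z : {A : Finset (Fin n) // A.card = i} → MvPolynomial (Fin n) K)
    (A : {A : Finset (Fin n) // A.card = i}) : extend z A.1 = z A :=
  dif_pos A.2

theorem extend_of_card_ne {i : ℕ}
    (z : {A : Finset (Fin n) // A.card = i} → MvPolynomial (Fin n) K) {A : Finset (Fin n)}
    (h : A.card ≠ i) : extend z A = 0 :=
  dif_neg h

theorem d_extend_of_card_ne {i : ℕ}
    (z : {A : Finset (Fin n) // A.card = i + 1} → MvPolynomial (Fin n) K) {B : Finset (Fin n)}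
    (h : B.card ≠ i) : d (extend z) B = 0 := by
  refine sum_eq_zero fun t ht => ?_
  rw [extend_of_card_ne, mul_zero, smul_zero]
  rw [card_insert_of_notMem (mem_compl.mp ht)]
  omega

/-- The differential of the Koszul complex. -/
noncomputable def differential (n : ℕ) (K : Type*) [Field K] (i : ℕ) :
    ({A : Finset (Fin n) // A.card = i + 1} → MvPolynomial (Fin n) K) →ₗ[MvPolynomial (Fin n) K]
      ({A : Finset (Fin n) // A.card = i} → MvPolynomial (Fin n) K) :=
  (koszulComplex n K).d i

/-- The matrix sums over pairs `t ∈ A` with `B = A \ {t}`; these are the pairs `t ∉ B` with `A = B ∪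
{t}`. -/
theorem differential_apply (i : ℕ)
    (z : {A : Finset (Fin n) // A.card = i + 1} → MvPolynomial (Fin n) K)
    (B : {A : Finset (Fin n) // A.card = i}) :
    differential n K i z B = d (extend z) B.1 := by
  have hdiff : differential n K i z B =
      ∑ A : {A : Finset (Fin n) // A.card = i + 1}, (∑ t ∈ A.1, if B.1 = A.1.erase t then
        (-1) ^ (A.1.filter (fun u => u < t)).card * X t else 0) * z A := rfl
  have hterm : ∀ A : {A : Finset (Fin n) // A.card = i + 1},
      (∑ t ∈ A.1, if B.1 = A.1.erase t then
        (-1) ^ (A.1.filter (fun u => u < t)).card * X t else 0) * z A =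
      ∑ t ∈ B.1ᶜ, if A.1 = insert t B.1 then sign K t B.1 • (X t * z A) else 0 := by
    intro A
    rw [sum_mul, ← sum_filter_add_sum_filter_not A.1 (fun t => B.1 = A.1.erase t)]
    rw [sum_eq_zero (s := A.1.filter (fun t => ¬ B.1 = A.1.erase t)), add_zero, ← sum_filter]
    · refine sum_congr ?_ fun t ht => ?_
      · ext t
        simp only [mem_filter, mem_compl]
        constructor
        · rintro ⟨h1, h2⟩
          rw [h2, insert_erase h1]
          exact ⟨notMem_erase t _, rfl⟩
        · rintro ⟨h1, h2⟩
          rw [h2, erase_insert h1]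
          exact ⟨mem_insert_self t _, rfl⟩
      · simp only [mem_filter, mem_compl] at ht
        rw [if_pos (by rw [ht.2, erase_insert ht.1]), ht.2, ← sign_insert_self t B.1, sign,
          smul_eq_C_mul, map_pow, map_neg, map_one, mul_assoc]
    · intro t ht
      rw [if_neg (mem_filter.mp ht).2, zero_mul]
  rw [hdiff, sum_congr rfl fun A _ => hterm A, sum_comm, d]
  refine sum_congr rfl fun t ht => ?_
  have hcard : (insert t B.1).card = i + 1 := by
    rw [card_insert_of_notMem (mem_compl.mp ht), B.2]
  rw [sum_eq_single ⟨insert t B.1, hcard⟩, if_pos rfl, ← extend_apply z ⟨insert t B.1, hcard⟩]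
  · intro A _ hA
    exact if_neg fun h => hA (Subtype.ext h)
  · intro h
    exact absurd (mem_univ _) h

theorem extend_differential (i : ℕ)
    (z : {A : Finset (Fin n) // A.card = i + 1} → MvPolynomial (Fin n) K) :
    extend (differential n K i z) = d (extend z) := by
  ext1 B
  by_cases h : B.card = i
  · exact (extend_apply _ ⟨B, h⟩).trans (differential_apply i z ⟨B, h⟩)
  · rw [extend_of_card_ne _ h, d_extend_of_card_ne z h]

/-- The homotopy raises cardinality by one, so it restricts to a single homological degree. -/
theorem exists_differential_eq {i : ℕ}
    (z : {A : Finset (Fin n) // A.card = i} → MvPolynomial (Fin n) K)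
    (hz : ∀ B, d (extend z) B = 0) (h0 : constantCoeff (extend z ∅) = 0) :
    ∃ w, differential n K i w = z := by
  refine ⟨fun A => homotopy (extend z) A.1, funext fun B => ?_⟩
  have hext : extend (fun A : {A : Finset (Fin n) // A.card = i + 1} =>
      homotopy (extend z) A.1) = homotopy (extend z) := by
    ext1 A
    by_cases h : A.card = i + 1
    · exact extend_apply _ ⟨A, h⟩
    · rw [extend_of_card_ne _ h, homotopy]
      split_ifs with hA
      · rw [extend_of_card_ne]
        · ext c; simp
        · rw [card_erase_of_mem (min'_mem A hA)]
          have := hA.card_pos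
          omega
      · rfl
  rw [differential_apply, hext, d_homotopy hz h0, extend_apply]

end KoszulChain

/-! ### The Koszul complex as a minimal resolution -/

section

open MvPolynomial KoszulChain

variable (n : ℕ) (K : Type*) [Field K]

theorem constantCoeff_eq_zero_of_mem_span_range_X {p : MvPolynomial (Fin n) K}
    (hp : p ∈ Ideal.span (Set.range (X : Fin n → MvPolynomial (Fin n) K))) :
    constantCoeff p = 0 := by
  have h : Ideal.span (Set.range (X : Fin n → MvPolynomial (Fin n) K)) ≤
      RingHom.ker (constantCoeff (R := K) (σ := Fin n)) := by
    rw [Ideal.span_le]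
    rintro _ ⟨i, rfl⟩
    exact constantCoeff_X K i
  exact h hp

theorem koszulComplex_diff_isHomogeneous {i : ℕ} (B : {A : Finset (Fin n) // A.card = i})
    (A : {A : Finset (Fin n) // A.card = i + 1}) :
    ((koszulComplex n K).diff i B A).IsHomogeneous 1 := by
  have hdiff : (koszulComplex n K).diff i B A = ∑ t ∈ A.1, if B.1 = A.1.erase t then
    (-1) ^ (A.1.filter (fun u => u < t)).card * X t else 0 := rfl
  rw [hdiff]
  refine IsHomogeneous.sum _ _ _ fun t _ => ?_
  split_ifs
  · have h : (-1 : MvPolynomial (Fin n) K) ^ (A.1.filter (fun u => u < t)).card =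
        C ((-1) ^ (A.1.filter (fun u => u < t)).card) := by rw [map_pow, map_neg, map_one]
    rw [h, ← zero_add 1]
    exact (isHomogeneous_C (Fin n) _).mul (isHomogeneous_X K t)
  · exact isHomogeneous_zero _ _ _

theorem exact_differential (i : ℕ) :
    Function.Exact (differential n K (i + 1)) (differential n K i) := by
  intro z
  constructor
  · intro hz
    refine exists_differential_eq z (fun B => ?_) ?_
    · rw [← extend_differential, hz]
      simp [extend]
    · rw [extend_of_card_ne _ (by simp), map_zero]
  · rintro ⟨w, rfl⟩
    ext1 B
    rw [differential_apply, extend_differential, d_d]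
    rfl

theorem koszulComplex_augmentation_apply {I : Ideal (MvPolynomial (Fin n) K)}
    (z : {A : Finset (Fin n) // A.card = 0} → MvPolynomial (Fin n) K) :
    Fintype.linearCombination (MvPolynomial (Fin n) K)
      (fun _ : {A : Finset (Fin n) // A.card = 0} => Ideal.Quotient.mk I 1) z =
    Ideal.Quotient.mk I (z ⟨∅, rfl⟩) := by
  have huniv : (Finset.univ : Finset {A : Finset (Fin n) // A.card = 0}) = {⟨∅, rfl⟩} := by
    ext A
    simpa [Subtype.ext_iff] using Finset.card_eq_zero.mp A.2
  rw [Fintype.linearCombination_apply, huniv, Finset.sum_singleton, ← Ideal.Quotient.mk_eq_mk,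
    ← Submodule.Quotient.mk_smul, smul_eq_mul, mul_one, Ideal.Quotient.mk_eq_mk]

theorem exact_differential_augmentation : Function.Exact (differential n K 0)
    (Fintype.linearCombination (MvPolynomial (Fin n) K)
      (fun _ : {A : Finset (Fin n) // A.card = 0} => Ideal.Quotient.mk
        (Ideal.span (Set.range (X : Fin n → MvPolynomial (Fin n) K))) 1)) := by
  intro z
  rw [koszulComplex_augmentation_apply, Ideal.Quotient.eq_zero_iff_mem]
  constructor
  · intro hz
    refine exists_differential_eq z (fun B => ?_) ?_
    · refine Finset.sum_eq_zero fun t _ => ?_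
      rw [extend_of_card_ne _ (by simp), mul_zero, smul_zero]
    · exact (congrArg constantCoeff (extend_apply z ⟨∅, rfl⟩)).trans
        (constantCoeff_eq_zero_of_mem_span_range_X n K hz)
  · rintro ⟨w, rfl⟩
    rw [differential_apply]
    refine Ideal.sum_mem _ fun t _ => ?_
    rw [smul_eq_C_mul]
    exact Ideal.mul_mem_left _ _
      (Ideal.mul_mem_right _ _ (Ideal.subset_span (Set.mem_range_self t)))

theorem koszulComplex_isMinimalResolution : (koszulComplex n K).IsMinimalResolution
    (Ideal.span (Set.range (X : Fin n → MvPolynomial (Fin n) K))) where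
  graded i B A := Or.inr ⟨1, add_comm 1 i, koszulComplex_diff_isHomogeneous n K B A⟩
  minimal i B A := by
    rw [constantCoeff_eq]
    exact (koszulComplex_diff_isHomogeneous n K B A).coeff_eq_zero (by simp)
  exact := exact_differential n K
  augmented := by
    refine ⟨fun _ => 1, fun _ => isHomogeneous_one _ _, exact_differential_augmentation n K,
      fun x => ?_⟩
    obtain ⟨p, rfl⟩ := Ideal.Quotient.mk_surjective x
    exact ⟨fun _ => p, koszulComplex_augmentation_apply n K _⟩

end

open MvPolynomial

/-! ### Graded parts and linear maps of graded free modules -/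

section GradedFreeModule

variable {V K ι κ : Type*} [Field K]

attribute [local instance] MvPolynomial.gradedAlgebra in
theorem MvPolynomial.IsHomogeneous.homogeneousComponent_mul {p : MvPolynomial V K} {e : ℕ}
    (hp : p.IsHomogeneous e) (q : MvPolynomial V K) (k : ℕ) :
    homogeneousComponent k (p * q) = if e ≤ k then p * homogeneousComponent (k - e) q else 0 := by
  have h := DirectSum.coe_decompose_mul_of_left_mem (homogeneousSubmodule V K) (b := q) k
    ((mem_homogeneousSubmodule e p).mpr hp)
  have hdec : ∀ (r : MvPolynomial V K) (j : ℕ),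
      (DirectSum.decompose (homogeneousSubmodule V K) r j : MvPolynomial V K) =
        homogeneousComponent j r := fun r j => decomposition.decompose'_apply r j
  rwa [hdec, hdec] at h

/-- The degree `j` part of an element of the free module `⊕_a S[-δ a]`. -/
noncomputable def gradedPart (δ : ι → ℕ) (j : ℕ) (v : ι → MvPolynomial V K) :
    ι → MvPolynomial V K :=
  fun a => if δ a ≤ j then homogeneousComponent (j - δ a) (v a) else 0

theorem gradedPart_eq_self_iff {δ : ι → ℕ} {j : ℕ} {v : ι → MvPolynomial V K} :
    gradedPart δ j v = v ↔ ∀ a, v a = 0 ∨ ∃ e, e + δ a = j ∧ (v a).IsHomogeneous e := by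
  rw [funext_iff]
  refine forall_congr' fun a => ?_
  rw [gradedPart]
  split_ifs with h
  · constructor
    · intro h'
      exact Or.inr ⟨j - δ a, Nat.sub_add_cancel h, h' ▸ homogeneousComponent_isHomogeneous _ _⟩
    · rintro (h' | ⟨e, rfl, h'⟩)
      · rw [h', map_zero]
      · rw [Nat.add_sub_cancel, homogeneousComponent_eq_self h']
  · constructor
    · exact fun h' => Or.inl h'.symm
    · rintro (h' | ⟨e, rfl, h'⟩)
      · exact h'.symm
      · exact absurd (Nat.le_add_left _ _) h

theorem gradedPart_gradedPart (δ : ι → ℕ) (j : ℕ) (v : ι → MvPolynomial V K) :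
    gradedPart δ j (gradedPart δ j v) = gradedPart δ j v := by
  rw [gradedPart_eq_self_iff]
  intro a
  by_cases h : δ a ≤ j
  · exact Or.inr ⟨j - δ a, Nat.sub_add_cancel h, by
      rw [gradedPart, if_pos h]; exact homogeneousComponent_isHomogeneous _ _⟩
  · exact Or.inl (if_neg h)

theorem linearMap_apply_eq_sum [Fintype ι] [DecidableEq ι] {M : Type*} [AddCommGroup M]
    [Module (MvPolynomial V K) M] (φ : (ι → MvPolynomial V K) →ₗ[MvPolynomial V K] M)
    (v : ι → MvPolynomial V K) : φ v = ∑ a, v a • φ (Pi.single a 1) := by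
  conv_lhs => rw [pi_eq_sum_univ' v]
  rw [map_sum]
  exact Finset.sum_congr rfl fun a _ => by rw [map_smul]

theorem constantCoeff_map_eq_zero [Fintype ι]
    (φ : (ι → MvPolynomial V K) →ₗ[MvPolynomial V K] (κ → MvPolynomial V K))
    {v : ι → MvPolynomial V K} (hv : ∀ a, constantCoeff (v a) = 0) (b : κ) :
    constantCoeff (φ v b) = 0 := by
  classical
  rw [linearMap_apply_eq_sum φ v, Finset.sum_apply, map_sum]
  exact Finset.sum_eq_zero fun a _ => by rw [Pi.smul_apply, smul_eq_mul, map_mul, hv, zero_mul]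

/-- A linear map of graded free modules that sends basis elements to homogeneous elements of the
same degree commutes with taking graded parts. -/
theorem map_gradedPart [Fintype ι] [DecidableEq ι] {δ : ι → ℕ} {δ' : κ → ℕ}
    (φ : (ι → MvPolynomial V K) →ₗ[MvPolynomial V K] (κ → MvPolynomial V K))
    (hφ : ∀ a, gradedPart δ' (δ a) (φ (Pi.single a 1)) = φ (Pi.single a 1))
    (j : ℕ) (v : ι → MvPolynomial V K) : φ (gradedPart δ j v) = gradedPart δ' j (φ v) := by
  ext1 b
  have hL : ∀ w, φ w b = ∑ a, φ (Pi.single a 1) b * w a := by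
    intro w
    rw [linearMap_apply_eq_sum φ w, Finset.sum_apply]
    exact Finset.sum_congr rfl fun a _ => mul_comm _ _
  have hR : gradedPart δ' j (φ v) b = ∑ a, if δ' b ≤ j then
      homogeneousComponent (j - δ' b) (φ (Pi.single a 1) b * v a) else 0 := by
    rw [gradedPart, hL, map_sum]
    split_ifs
    · rfl
    · exact Finset.sum_const_zero.symm
  rw [hL, hR]
  refine Finset.sum_congr rfl fun a _ => ?_
  rw [gradedPart]
  rcases gradedPart_eq_self_iff.mp (hφ a) b with h | ⟨e, he, h⟩
  · simp [h]
  · rw [h.homogeneousComponent_mul]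
    by_cases h1 : δ a ≤ j
    · rw [if_pos h1, if_pos (by omega), if_pos (by omega), show j - δ' b - e = j - δ a by omega]
    · rw [if_neg h1, mul_zero]
      by_cases h2 : δ' b ≤ j
      · rw [if_pos h2, if_neg (by omega)]
      · rw [if_neg h2]

/-- Projectivity of a free module; `P` records a property, such as homogeneity, of the chosen lifts
of basis elements. -/
theorem exists_linearMap_comp_eq [Fintype ι] [DecidableEq ι] {M N : Type*}
    [AddCommGroup M] [Module (MvPolynomial V K) M] [AddCommGroup N] [Module (MvPolynomial V K) N]
    (α : (ι → MvPolynomial V K) →ₗ[MvPolynomial V K] M) (β : N →ₗ[MvPolynomial V K] M)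
    (P : ι → N → Prop) (h : ∀ a, ∃ x, β x = α (Pi.single a 1) ∧ P a x) :
    ∃ γ : (ι → MvPolynomial V K) →ₗ[MvPolynomial V K] N,
      (∀ v, β (γ v) = α v) ∧ ∀ a, P a (γ (Pi.single a 1)) := by
  choose x hx hP using h
  have hs : ∀ a, Fintype.linearCombination (MvPolynomial V K) x (Pi.single a 1) = x a := by
    intro a
    rw [Fintype.linearCombination_apply_single, one_smul]
  refine ⟨Fintype.linearCombination (MvPolynomial V K) x, fun v => ?_, fun a => ?_⟩
  · rw [linearMap_apply_eq_sum α v, Fintype.linearCombination_apply, map_sum]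
    exact Finset.sum_congr rfl fun a _ => by rw [map_smul, hx]
  · rw [hs]
    exact hP a

/-- If a graded map `φ` of graded free modules has a left inverse modulo `(x_1, …, x_n)`, then the
target has in each degree at least as many basis elements as the source. -/
theorem card_le_card_of_leftInverse_mod [Fintype ι] [DecidableEq ι] [Fintype κ] [DecidableEq κ]
    {δ : ι → ℕ} {δ' : κ → ℕ}
    (φ : (ι → MvPolynomial V K) →ₗ[MvPolynomial V K] (κ → MvPolynomial V K))
    (ψ : (κ → MvPolynomial V K) →ₗ[MvPolynomial V K] (ι → MvPolynomial V K))
    (hφ : ∀ a, gradedPart δ' (δ a) (φ (Pi.single a 1)) = φ (Pi.single a 1))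
    (h : ∀ v b, constantCoeff ((ψ (φ v) - v) b) = 0) (j : ℕ) :
    Nat.card {a // δ a = j} ≤ Nat.card {b // δ' b = j} := by
  let A : Matrix {b // δ' b = j} {a // δ a = j} K :=
    fun b a => constantCoeff (φ (Pi.single a.1 1) b.1)
  let B : Matrix {a // δ a = j} {b // δ' b = j} K :=
    fun a b => constantCoeff (ψ (Pi.single b.1 1) a.1)
  have hBA : B * A = 1 := by
    ext a a'
    have h' := h (Pi.single a'.1 1) a.1
    rw [Pi.sub_apply, map_sub, sub_eq_zero, linearMap_apply_eq_sum ψ, Finset.sum_apply,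
      map_sum] at h'
    -- An entry between basis elements of different degrees is zero or has positive degree, so only
    -- the degree `j` block of `φ` contributes to the product modulo the variables.
    have hzero : ∀ c, δ' c ≠ j → constantCoeff (φ (Pi.single a'.1 1) c) = 0 := by
      intro c hc
      rcases gradedPart_eq_self_iff.mp (hφ a'.1) c with h0 | ⟨e, he, h0⟩
      · rw [h0, map_zero]
      · rw [constantCoeff_eq]
        refine h0.coeff_eq_zero ?_
        have := a'.2
        simp only [map_zero]
        omega
    have hone : constantCoeff ((Pi.single a'.1 1 : ι → MvPolynomial V K) a.1) =
        (1 : Matrix {a // δ a = j} {a // δ a = j} K) a a' := by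
      by_cases haa : a = a'
      · subst haa
        rw [Pi.single_eq_same, Matrix.one_apply_eq, map_one]
      · rw [Pi.single_eq_of_ne (fun h => haa (Subtype.ext h)), Matrix.one_apply_ne haa, map_zero]
    rw [← hone, ← h', Matrix.mul_apply]
    have hterm : ∀ c, constantCoeff ((φ (Pi.single a'.1 1) c • ψ (Pi.single c 1)) a.1) =
        constantCoeff (ψ (Pi.single c 1) a.1) * constantCoeff (φ (Pi.single a'.1 1) c) := by
      intro c
      rw [Pi.smul_apply, smul_eq_mul, map_mul, mul_comm]
    rw [Finset.sum_congr rfl fun c _ => hterm c,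
      ← Finset.sum_filter_of_ne (p := fun c => δ' c = j) (fun c _ hc => by
        by_contra hne
        exact hc (by rw [hzero c hne, mul_zero])),
      Finset.sum_subtype _ (p := fun c => δ' c = j) (by simp)]
  rw [Nat.card_eq_fintype_card, Nat.card_eq_fintype_card,
    ← Matrix.rank_one (R := K) (n := {a // δ a = j}), ← hBA]
  exact (Matrix.rank_mul_le_right B A).trans A.rank_le_card_height

end GradedFreeModule

/-! ### Uniqueness of graded Betti numbers -/

namespace FreeSequence

variable {V K : Type*} [Field K] {F G : FreeSequence V K} {I : Ideal (MvPolynomial V K)}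

theorem IsMinimalResolution.gradedPart_d_single (hF : F.IsMinimalResolution I) (i : ℕ)
    [DecidableEq (F.index (i + 1))] (a : F.index (i + 1)) :
    gradedPart (F.deg i) (F.deg (i + 1) a) (F.d i (Pi.single a 1)) = F.d i (Pi.single a 1) := by
  rw [gradedPart_eq_self_iff]
  intro b
  rw [d, Matrix.mulVecLin_apply, Matrix.mulVec_single_one]
  exact hF.graded i b a

theorem IsMinimalResolution.constantCoeff_d (hF : F.IsMinimalResolution I) (i : ℕ)
    (v : F.index (i + 1) → MvPolynomial V K) (b : F.index i) :
    constantCoeff (F.d i v b) = 0 := by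
  rw [d, Matrix.mulVecLin_apply, Matrix.mulVec, dotProduct, map_sum]
  exact Finset.sum_eq_zero fun a _ => by rw [map_mul, hF.minimal, zero_mul]

/-- Maps `φ : F_i → G_i` and `ψ : G_i → F_i` that are part of chain maps over the identity of `S/I`,
with `ψ ∘ φ` homotopic to the identity. -/
def ComparableAt (F G : FreeSequence V K) (i : ℕ) [DecidableEq (F.index i)] : Prop :=
  ∃ (φ : (F.index i → MvPolynomial V K) →ₗ[MvPolynomial V K] (G.index i → MvPolynomial V K))
    (ψ : (G.index i → MvPolynomial V K) →ₗ[MvPolynomial V K] (F.index i → MvPolynomial V K))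
    (h : (F.index i → MvPolynomial V K) →ₗ[MvPolynomial V K]
      (F.index (i + 1) → MvPolynomial V K)),
    (∀ a, gradedPart (G.deg i) (F.deg i a) (φ (Pi.single a 1)) = φ (Pi.single a 1)) ∧
    (∀ x, φ (F.d i x) ∈ LinearMap.range (G.d i)) ∧
    (∀ y, ψ (G.d i y) ∈ LinearMap.range (F.d i)) ∧
    (∀ x, ψ (φ (F.d i x)) - F.d i x = F.d i (h (F.d i x))) ∧
    ∀ x b, constantCoeff ((ψ (φ x) - x) b) = 0

/-- A lift of the augmentation may be replaced by its graded part because `I` is homogeneous. Here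
`ψ ∘ φ - 1 = d ∘ h`, which vanishes modulo the variables by minimality. -/
theorem ComparableAt.zero (hF : F.IsMinimalResolution I) (hG : G.IsMinimalResolution I)
    (hI : ∀ p ∈ I, ∀ j, homogeneousComponent j p ∈ I) [DecidableEq (F.index 0)] :
    ComparableAt F G 0 := by
  classical
  obtain ⟨f, hf, hfe, hfs⟩ := hF.augmented
  obtain ⟨g, hg, hge, hgs⟩ := hG.augmented
  set εF := Fintype.linearCombination (MvPolynomial V K) (fun b => Ideal.Quotient.mk I (f b))
  set εG := Fintype.linearCombination (MvPolynomial V K) (fun b => Ideal.Quotient.mk I (g b))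
    with hεG
  -- A lift of `εG` to the free module `S` of rank one, so that `map_gradedPart` applies.
  let γ : (G.index 0 → MvPolynomial V K) →ₗ[MvPolynomial V K] (Unit → MvPolynomial V K) :=
    Fintype.linearCombination (MvPolynomial V K) (fun b _ => g b)
  have hγ : ∀ v, εG v = Ideal.Quotient.mk I (γ v ()) := by
    intro v
    rw [hεG, Fintype.linearCombination_apply, Fintype.linearCombination_apply, Finset.sum_apply,
      map_sum]
    rfl
  obtain ⟨φ, hφ, hφgr⟩ := exists_linearMap_comp_eq εF εG
    (fun a v => gradedPart (G.deg 0) (F.deg 0 a) v = v) (fun a => by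
      obtain ⟨v, hv⟩ := hgs (εF (Pi.single a 1))
      refine ⟨gradedPart (G.deg 0) (F.deg 0 a) v, ?_, gradedPart_gradedPart _ _ _⟩
      have hεa : εF (Pi.single a 1) = Ideal.Quotient.mk I (f a) := by
        rw [Fintype.linearCombination_apply_single, one_smul]
      have hcomm := map_gradedPart (δ := G.deg 0) (δ' := fun _ : Unit => 0) γ (fun b => by
        rw [gradedPart_eq_self_iff]
        intro _
        refine Or.inr ⟨G.deg 0 b, rfl, ?_⟩
        rw [Fintype.linearCombination_apply_single, one_smul]
        exact hg b) (F.deg 0 a) v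
      rw [hεa, hγ, Ideal.Quotient.eq] at hv
      rw [hεa, hγ, Ideal.Quotient.eq, hcomm]
      have := hI _ hv (F.deg 0 a)
      rw [map_sub, homogeneousComponent_eq_self (hf a)] at this
      simpa [gradedPart] using this)
  obtain ⟨ψ, hψ, -⟩ := exists_linearMap_comp_eq εG εF (fun _ _ => True)
    (fun a => (hfs _).imp fun x hx => ⟨hx, trivial⟩)
  obtain ⟨h, hh, -⟩ := exists_linearMap_comp_eq (ψ ∘ₗ φ - LinearMap.id :
      (F.index 0 → MvPolynomial V K) →ₗ[MvPolynomial V K] _) (F.d 0)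
    (fun _ _ => True) (fun a => by
      obtain ⟨x, hx⟩ := (hfe _).mp (show εF ((ψ ∘ₗ φ - LinearMap.id :
          (F.index 0 → MvPolynomial V K) →ₗ[MvPolynomial V K] _) (Pi.single a 1)) = 0 by
        rw [LinearMap.sub_apply, map_sub, LinearMap.comp_apply, hψ, hφ, LinearMap.id_apply,
          sub_self])
      exact ⟨x, hx, trivial⟩)
  refine ⟨φ, ψ, h, hφgr, fun x => ?_, fun y => ?_, fun x => (hh _).symm, fun x b => ?_⟩
  · exact (hge _).mp (by rw [hφ]; exact (hfe _).mpr ⟨x, rfl⟩)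
  · exact (hfe _).mp (by rw [hψ]; exact (hge _).mpr ⟨y, rfl⟩)
  · exact (congrArg (fun v => constantCoeff (v b)) (hh x)).symm.trans (hF.constantCoeff_d 0 _ b)

/-- The comparison theorem one degree up, with `φ'` kept graded. Now `ψ' ∘ φ' - 1 = d ∘ h' + h ∘ d`,
and both terms vanish modulo the variables by minimality of `F`. -/
theorem ComparableAt.succ (hF : F.IsMinimalResolution I) (hG : G.IsMinimalResolution I) {i : ℕ}
    [DecidableEq (F.index i)] [DecidableEq (F.index (i + 1))] (hi : ComparableAt F G i) :
    ComparableAt F G (i + 1) := by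
  classical
  obtain ⟨φ, ψ, h, hφgr, hφ, hψ, hh, -⟩ := hi
  obtain ⟨φ', hφ', hφgr'⟩ := exists_linearMap_comp_eq (φ ∘ₗ F.d i) (G.d i)
    (fun a v => gradedPart (G.deg (i + 1)) (F.deg (i + 1) a) v = v) (fun a => by
      obtain ⟨v, hv⟩ := hφ (Pi.single a 1)
      refine ⟨gradedPart (G.deg (i + 1)) (F.deg (i + 1) a) v, ?_, gradedPart_gradedPart _ _ _⟩
      rw [map_gradedPart (δ' := G.deg i) (G.d i) (hG.gradedPart_d_single i), hv,
        ← map_gradedPart (δ := F.deg i) φ hφgr, hF.gradedPart_d_single, LinearMap.comp_apply])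
  obtain ⟨ψ', hψ', -⟩ := exists_linearMap_comp_eq (ψ ∘ₗ G.d i) (F.d i) (fun _ _ => True)
    (fun a => (hψ (Pi.single a 1)).imp fun x hx => ⟨hx, trivial⟩)
  obtain ⟨h', hh', -⟩ := exists_linearMap_comp_eq (ψ' ∘ₗ φ' - LinearMap.id - h ∘ₗ F.d i :
      (F.index (i + 1) → MvPolynomial V K) →ₗ[MvPolynomial V K] _)
    (F.d (i + 1)) (fun _ _ => True) (fun a => by
      obtain ⟨x, hx⟩ := (hF.exact i _).mp (show F.d i
          ((ψ' ∘ₗ φ' - LinearMap.id - h ∘ₗ F.d i :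
            (F.index (i + 1) → MvPolynomial V K) →ₗ[MvPolynomial V K] _) (Pi.single a 1)) = 0 by
        simp only [LinearMap.sub_apply, map_sub, LinearMap.comp_apply, hψ', hφ',
          LinearMap.id_apply, ← hh, sub_self])
      exact ⟨x, hx, trivial⟩)
  have hdd : ∀ x, F.d i (F.d (i + 1) x) = 0 := fun x => (hF.exact i _).mpr ⟨x, rfl⟩
  have hdd' : ∀ x, G.d i (G.d (i + 1) x) = 0 := fun x => (hG.exact i _).mpr ⟨x, rfl⟩
  refine ⟨φ', ψ', h', hφgr', fun x => ?_, fun y => ?_, fun x => ?_, fun x b => ?_⟩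
  · exact (hG.exact i _).mp (by rw [hφ', LinearMap.comp_apply, hdd, map_zero])
  · exact (hF.exact i _).mp (by rw [hψ', LinearMap.comp_apply, hdd', map_zero])
  · simp [hh', hdd]
  · have h1 := congrArg (fun v => constantCoeff (v b)) (hh' x)
    simp only [hF.constantCoeff_d, LinearMap.sub_apply, LinearMap.comp_apply, LinearMap.id_apply,
      Pi.sub_apply, map_sub] at h1
    rw [constantCoeff_map_eq_zero h (hF.constantCoeff_d i x) b, sub_zero] at h1
    rw [Pi.sub_apply, map_sub, ← h1]

theorem gradedRank_le (hF : F.IsMinimalResolution I) (hG : G.IsMinimalResolution I)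
    (hI : ∀ p ∈ I, ∀ j, homogeneousComponent j p ∈ I) (i j : ℕ) :
    F.gradedRank i j ≤ G.gradedRank i j := by
  classical
  have h : ComparableAt F G i := by
    induction i with
    | zero => exact .zero hF hG hI
    | succ i ih => exact ih.succ hF hG
  obtain ⟨φ, ψ, -, hφ, -, -, -, hc⟩ := h
  exact card_le_card_of_leftInverse_mod φ ψ hφ hc j

theorem gradedRank_eq (hF : F.IsMinimalResolution I) (hG : G.IsMinimalResolution I)
    (hI : ∀ p ∈ I, ∀ j, homogeneousComponent j p ∈ I) (i j : ℕ) :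
    F.gradedRank i j = G.gradedRank i j :=
  (gradedRank_le hF hG hI i j).antisymm (gradedRank_le hG hF hI i j)

end FreeSequence

attribute [local instance] MvPolynomial.gradedAlgebra in
theorem homogeneousComponent_mem_span {V K : Type*} [Field K] {s : Set (MvPolynomial V K)}
    (hs : ∀ p ∈ s, ∃ e, p.IsHomogeneous e) {p : MvPolynomial V K} (hp : p ∈ Ideal.span s) (j : ℕ) :
    homogeneousComponent j p ∈ Ideal.span s :=
  (mem_iff_homogeneousComponent_mem
    (Ideal.homogeneous_span (homogeneousSubmodule V K) s hs) p).mp hp j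

theorem hasGradedBettiNumbers_span {V K : Type*} [Field K] {s : Set (MvPolynomial V K)}
    (hs : ∀ p ∈ s, ∃ e, p.IsHomogeneous e) {F : FreeSequence V K}
    (hF : F.IsMinimalResolution (Ideal.span s)) :
    HasGradedBettiNumbers (Ideal.span s) F.gradedRank :=
  ⟨⟨F, hF⟩, fun _ hG i j => FreeSequence.gradedRank_eq hG hF
    (fun _ hp j => homogeneousComponent_mem_span hs hp j) i j⟩

/-! ### The resolution of a principal ideal and the graded ranks -/

/-- The index type of the basis of `F_i` in a free sequence with `F_0` and `F_1` of rank one and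
`F_i = 0` for `i ≥ 2`. -/
abbrev PrincipalIndex (i : ℕ) : Type := {_u : Unit // i ≤ 1}

/-- The resolution `0 ← S ← S[-m] ← 0` of `S / (f)` for a form `f` of degree `m`. -/
noncomputable def principalResolution {V K : Type*} [Field K] (f : MvPolynomial V K) (m : ℕ) :
    FreeSequence V K where
  index := fun i => PrincipalIndex i
  deg := fun i _ => i * m
  -- Only the matrix for `i = 0` has entries; for `i ≥ 1` it has no columns.
  diff := fun _ _ _ => f

section PrincipalResolution

variable {V K : Type*} [Field K] {f : MvPolynomial V K} {m : ℕ}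

/-- The differential `S[-m] → S` of the resolution of `S / (f)`. -/
noncomputable def principalDifferential (f : MvPolynomial V K) (m : ℕ) :
    (PrincipalIndex 1 → MvPolynomial V K) →ₗ[MvPolynomial V K]
      (PrincipalIndex 0 → MvPolynomial V K) :=
  (principalResolution f m).d 0

theorem principalDifferential_apply
    (z : PrincipalIndex 1 → MvPolynomial V K) (b : PrincipalIndex 0) :
    principalDifferential f m z b = f * z ⟨(), le_rfl⟩ := by
  change ∑ a : PrincipalIndex 1, f * z a = _
  rw [Fintype.sum_eq_single ⟨(), le_rfl⟩ fun x hx => absurd (Subsingleton.elim _ _) hx]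

theorem principalResolution_augmentation_apply {I : Ideal (MvPolynomial V K)}
    (z : PrincipalIndex 0 → MvPolynomial V K) :
    Fintype.linearCombination (MvPolynomial V K)
      (fun _ : PrincipalIndex 0 => Ideal.Quotient.mk I 1) z =
    Ideal.Quotient.mk I (z ⟨(), Nat.zero_le 1⟩) := by
  rw [Fintype.linearCombination_apply,
    Fintype.sum_eq_single ⟨(), Nat.zero_le 1⟩ fun x hx => absurd (Subsingleton.elim _ _) hx,
    ← Ideal.Quotient.mk_eq_mk, ← Submodule.Quotient.mk_smul, smul_eq_mul, mul_one,
    Ideal.Quotient.mk_eq_mk]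

theorem principalResolution_augmentation_surjective {I : Ideal (MvPolynomial V K)} :
    Function.Surjective (Fintype.linearCombination (MvPolynomial V K)
      (fun _ : PrincipalIndex 0 => Ideal.Quotient.mk I 1)) := by
  intro x
  obtain ⟨p, rfl⟩ := Ideal.Quotient.mk_surjective x
  exact ⟨fun _ => p, principalResolution_augmentation_apply fun _ => p⟩

theorem exact_principalResolution_augmentation :
    Function.Exact (principalDifferential f m)
      (Fintype.linearCombination (MvPolynomial V K)
        (fun _ : PrincipalIndex 0 => Ideal.Quotient.mk (Ideal.span {f}) 1)) := by
  intro z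
  rw [principalResolution_augmentation_apply, Ideal.Quotient.eq_zero_iff_mem,
    Ideal.mem_span_singleton']
  constructor
  · rintro ⟨q, hq⟩
    refine ⟨fun _ => q, funext fun b => ?_⟩
    rw [principalDifferential_apply, mul_comm, hq]
  · rintro ⟨w, rfl⟩
    exact ⟨w ⟨(), le_rfl⟩, by rw [principalDifferential_apply, mul_comm]⟩

theorem principalResolution_isMinimalResolution (hf : f.IsHomogeneous m) (hf0 : f ≠ 0)
    (hm : m ≠ 0) : (principalResolution f m).IsMinimalResolution (Ideal.span {f}) where
  graded i b a := by
    have ha : i + 1 ≤ 1 := a.2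
    obtain rfl : i = 0 := by omega
    exact Or.inr ⟨m, by simp [principalResolution], hf⟩
  minimal i b a := by
    change constantCoeff f = 0
    rw [constantCoeff_eq]
    exact hf.coeff_eq_zero (by simpa using hm.symm)
  exact i z := by
    have hempty : ∀ k, IsEmpty ((principalResolution f m).index (k + 2)) := fun k =>
      ⟨fun a => absurd (show k + 2 ≤ 1 from a.2) (by omega)⟩
    -- The incoming module is zero, so exactness is injectivity: cancellation of `f` in a domain for
    -- `i = 0`, trivial beyond.
    have h0 : (principalResolution f m).d i z = 0 ↔ z = 0 := by
      refine ⟨fun hz => ?_, fun hz => by rw [hz, map_zero]⟩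
      cases i with
      | zero =>
        have h := congrFun hz ⟨(), Nat.zero_le 1⟩
        have h' := (principalDifferential_apply z _).symm.trans h
        exact funext fun a => (mul_eq_zero.mp h').resolve_left hf0
      | succ k => exact funext fun a => (hempty k).elim a
    rw [h0]
    constructor
    · rintro rfl
      exact ⟨0, map_zero _⟩
    · rintro ⟨w, rfl⟩
      rw [show w = 0 from funext fun a => (hempty i).elim a, map_zero]
  augmented := by
    refine ⟨fun _ => 1, fun _ => ?_, exact_principalResolution_augmentation,
      principalResolution_augmentation_surjective⟩
    simpa [principalResolution] using isHomogeneous_one V K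

theorem principalResolution_gradedRank (hm : m ≠ 0) (i j : ℕ) :
    (principalResolution f m).gradedRank i j =
      if (i = 0 ∧ j = 0) ∨ (i = 1 ∧ j = m) then 1 else 0 := by
  change Nat.card {_a : PrincipalIndex i // i * m = j} = _
  split_ifs with h
  · have : i ≤ 1 ∧ i * m = j := by
      rcases h with ⟨rfl, rfl⟩ | ⟨rfl, rfl⟩ <;> simp
    have : Nonempty {_a : PrincipalIndex i // i * m = j} := ⟨⟨⟨(), this.1⟩, this.2⟩⟩
    exact Nat.card_unique
  · have : IsEmpty {_a : PrincipalIndex i // i * m = j} := by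
      refine ⟨fun a => h ?_⟩
      obtain ⟨⟨_, hi⟩, hj⟩ := a
      rcases Nat.le_one_iff_eq_zero_or_eq_one.mp hi with rfl | rfl
      · exact Or.inl ⟨rfl, by simpa using hj.symm⟩
      · exact Or.inr ⟨rfl, by simpa using hj.symm⟩
    exact Nat.card_of_isEmpty

end PrincipalResolution

theorem koszulComplex_gradedRank (n : ℕ) (K : Type*) [Field K] (i j : ℕ) :
    (koszulComplex n K).gradedRank i j = if i = j then n.choose i else 0 := by
  change Nat.card {_a : {A : Finset (Fin n) // A.card = i} // i = j} = _
  split_ifs with h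
  · rw [Nat.card_congr (Equiv.subtypeUnivEquiv fun _ => h), Nat.card_eq_fintype_card,
      Fintype.card_finset_len, Fintype.card_fin]
  · have : IsEmpty {_a : {A : Finset (Fin n) // A.card = i} // i = j} := ⟨fun a => h a.2⟩
    exact Nat.card_of_isEmpty

/-! ### The Stanley–Reisner ideals and the main theorem -/

section TotalCutComplex

variable {V : Type*} [Fintype V] [DecidableEq V] (G : SimpleGraph V)

theorem mem_totalCutComplex_one_faces {F : Finset V} :
    F ∈ (totalCutComplex G 1).faces ↔ F ≠ Finset.univ := by
  constructor
  · rintro ⟨T, hT, hF⟩ rfl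
    obtain ⟨t, rfl⟩ := Finset.card_eq_one.mp hT.card_eq
    simpa using hF (Finset.mem_univ t)
  · intro hF
    obtain ⟨t, ht⟩ : ∃ t, t ∉ F := by
      by_contra! h
      exact hF (Finset.eq_univ_iff_forall.mpr h)
    refine ⟨{t}, ⟨by simp [SimpleGraph.IsIndepSet], Finset.card_singleton t⟩, fun u hu => ?_⟩
    rw [Finset.mem_compl, Finset.mem_singleton]
    rintro rfl
    exact ht hu

/-- The full vertex set is the only non-face. -/
theorem stanleyReisnerIdeal_totalCutComplex_one (K : Type*) [Field K] :
    stanleyReisnerIdeal K (totalCutComplex G 1) = Ideal.span {∏ i : V, X i} := by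
  rw [stanleyReisnerIdeal]
  congr 1
  ext p
  simp [mem_totalCutComplex_one_faces]

theorem stanleyReisnerIdeal_alexanderDual_totalCutComplex_one (K : Type*) [Field K] :
    stanleyReisnerIdeal K (totalCutComplex G 1).alexanderDual =
      Ideal.span (Set.range (X : V → MvPolynomial V K)) := by
  have hface : ∀ F : Finset V, F ∉ (totalCutComplex G 1).alexanderDual.faces ↔ F.Nonempty := by
    intro F
    change ¬ (Fᶜ ∉ (totalCutComplex G 1).faces) ↔ _
    rw [not_not, mem_totalCutComplex_one_faces, Ne, Finset.compl_eq_univ_iff,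
      Finset.nonempty_iff_ne_empty]
  refine le_antisymm (Ideal.span_le.mpr ?_) (Ideal.span_le.mpr ?_)
  · rintro p ⟨F, hF, rfl⟩
    obtain ⟨i, hi⟩ := (hface F).mp hF
    exact Ideal.mem_of_dvd _ (Finset.dvd_prod_of_mem X hi)
      (Ideal.subset_span (Set.mem_range_self i))
  · rintro _ ⟨i, rfl⟩
    exact Ideal.subset_span ⟨{i}, (hface _).mpr (Finset.singleton_nonempty i), by simp⟩

end TotalCutComplex

theorem mainTheorem12 (K : Type*) [Field K] (n : ℕ) (hn : 1 ≤ n) (G : SimpleGraph (Fin n)) :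
    -- `K[Δ_1^t(G)] = K[x_1, …, x_n] / (x_1 ⋯ x_n)`
    stanleyReisnerIdeal K (totalCutComplex G 1) =
      Ideal.span {∏ i : Fin n, MvPolynomial.X i} ∧
    -- the Stanley-Reisner ring of the Alexander dual is `K[x_1, …, x_n] / (x_1, …, x_n)`
    stanleyReisnerIdeal K (totalCutComplex G 1).alexanderDual =
      Ideal.span (Set.range (MvPolynomial.X : Fin n → MvPolynomial (Fin n) K)) ∧
    IsCohenMacaulayRing (StanleyReisnerRing K (totalCutComplex G 1)) ∧
    IsCohenMacaulayRing (StanleyReisnerRing K (totalCutComplex G 1).alexanderDual) ∧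
    HasLinearResolution (stanleyReisnerIdeal K (totalCutComplex G 1)) ∧
    HasLinearResolution (stanleyReisnerIdeal K (totalCutComplex G 1).alexanderDual) ∧
    HasGradedBettiNumbers (stanleyReisnerIdeal K (totalCutComplex G 1))
      (fun i j => if (i = 0 ∧ j = 0) ∨ (i = 1 ∧ j = n) then 1 else 0) ∧
    HasGradedBettiNumbers (stanleyReisnerIdeal K (totalCutComplex G 1).alexanderDual)
      (fun i j => if i = j then n.choose i else 0) ∧
    (koszulComplex n K).IsMinimalResolution
      (stanleyReisnerIdeal K (totalCutComplex G 1).alexanderDual) := by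
  have hprod : (∏ i : Fin n, X i : MvPolynomial (Fin n) K).IsHomogeneous n := by
    simpa using IsHomogeneous.prod Finset.univ (X : Fin n → MvPolynomial (Fin n) K) (fun _ => 1)
      fun i _ => isHomogeneous_X K i
  have hprod0 : (∏ i : Fin n, X i : MvPolynomial (Fin n) K) ≠ 0 :=
    Finset.prod_ne_zero_iff.mpr fun i _ => X_ne_zero i
  have hn0 : n ≠ 0 := by omega
  have hF := principalResolution_isMinimalResolution hprod hprod0 hn0
  have hK := koszulComplex_isMinimalResolution n K
  have hCM : IsCohenMacaulayRing (MvPolynomial (Fin n) K ⧸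
      Ideal.span {∏ i : Fin n, (X i : MvPolynomial (Fin n) K)}) := by
    -- The coordinate change singles out the variable `X 0`, hence needs `n = d + 1`.
    obtain ⟨d, rfl⟩ := Nat.exists_eq_succ_of_ne_zero hn0
    exact isCohenMacaulayRing_quotient_prod_X K d
  simp only [StanleyReisnerRing]
  rw [stanleyReisnerIdeal_totalCutComplex_one,
    stanleyReisnerIdeal_alexanderDual_totalCutComplex_one]
  refine ⟨rfl, rfl, hCM, isCohenMacaulayRing_quotient_range_X K n, ⟨n, _, hF, ?_⟩,
    ⟨1, _, hK, fun i _ => add_comm i 1⟩, ?_, ?_, hK⟩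
  · intro i a
    have ha : i + 1 ≤ 1 := a.2
    obtain rfl : i = 0 := by omega
    simp [principalResolution]
  · rw [← funext₂ (principalResolution_gradedRank (f := ∏ i : Fin n, (X i : MvPolynomial _ K)) hn0)]
    exact hasGradedBettiNumbers_span (by rintro p rfl; exact ⟨n, hprod⟩) hF
  · rw [← funext₂ (koszulComplex_gradedRank n K)]
    exact hasGradedBettiNumbers_span (by rintro _ ⟨i, rfl⟩; exact ⟨1, isHomogeneous_X K i⟩) hK
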